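/- Let $\mathbb{R}_+=(0,\infty)$. For $x\in\mathbb{R}$ and $\beta,\lambda\in\mathbb{R}_+$ let \begin{align*} \mathrm{LeakyReLU}_\beta(x)&=\begin{cases}x,&x\ge 0,\\ \beta x,&x<0,\end{cases}& \mathrm{ELU}_\beta(x)&=\begin{cases}x,&x\ge 0,\\ \beta(e^x-1),&x<0,\end{cases}\\ \mathrm{CELU}_\beta(x)&=\begin{cases}x,&x\ge 0,\\ \beta(e^{x/\beta}-1),&x<0,\end{cases}& \mathrm{SELU}_{(\lambda,\beta)}(x)&=\lambda\,\mathrm{ELU}_\beta(x),\\ \mathrm{Softplus}_\beta(x)&=\tfrac1\beta\ln(1+e^{\beta x}), \end{align*} and let $\mathrm{LeakyReLU}$, $\mathrm{ELU}$, $\mathrm{CELU}$, $\mathrm{SELU}$, $\mathrm{Softplus}$ denote the corresponding classes of functions, each with its parameters ranging over $\mathbb{R}_+$. For a class $\sigma$ of functions $\mathbb{R}\to\mathbb{R}$ and integers $m,n\ge 1$, $k\ge 0$, let $N^{\sigma}_{m,n,k}$ be the set of all functions $\mathbb{R}^m\to\mathbb{R}^n$ of the form $$T_L\circ\sigma_L\circ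 T_{L-1}\circ\cdots\circ\sigma_1\circ T_0,$$ where $L\ge 1$, $d_0=m$, $d_{L+1}=n$, $1\le d_1,\dots,d_L\le k$, each $T_i:\mathbb{R}^{d_i}\to\mathbb{R}^{d_{i+1}}$ is an affine map, and each $\sigma_i\in\sigma$ is applied componentwise (different layers may use different members of $\sigma$). Let $$w_{\min}(m,n,\sigma)=\min\bigl\{l\in\mathbb{N} : \forall f\in C(\mathbb{R}^m,\mathbb{R}^n)\ \forall K\subset\mathbb{R}^m\text{ compact}\ \forall\varepsilon>0\ \exists g\in N^{\sigma}_{m,n,l}:\ \sup_{x\in K}\|f(x)-g(x)\|_\infty<\varepsilon\bigr\}.$$ **Theorem (Minimum width for variants of ReLU).** Let $m,n\ge 1$ be integers and let $\sigma$ be one of the classes $\mathrm{LeakyReLU}$, $\mathrm{ELU}$, $\mathrm{SELU}$, $\mathrm{Softplus}$, $\mathrm{CELU}$. Then the set of $l$ in the definition of $w_{\min}(m,n,\sigma)$ is nonempty, and $$m+1\le w_{\min}(m,n,\sigma)\le m+n.$$ -/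

import Mathlib

namespace MinWidth

/-- `LeakyReLU_β`. -/
noncomputable def leakyReLU (β x : ℝ) : ℝ := if 0 ≤ x then x else β * x

/-- `ELU_β`. -/
noncomputable def elu (β x : ℝ) : ℝ := if 0 ≤ x then x else β * (Real.exp x - 1)

/-- `CELU_β`. -/
noncomputable def celu (β x : ℝ) : ℝ := if 0 ≤ x then x else β * (Real.exp (x / β) - 1)

/-- `SELU_(lam, β)`. -/
noncomputable def selu (lam β x : ℝ) : ℝ :=
  lam * (if 0 ≤ x then x else β * (Real.exp x - 1))

/-- `Softplus_β`. -/
noncomputable def softplus (β x : ℝ) : ℝ := 1 / β * Real.log (1 + Real.exp (β * x))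

/-- The class of all leaky rectified linear units with positive parameter. -/
def LeakyReLU : Set (ℝ → ℝ) := {s | ∃ β : ℝ, 0 < β ∧ s = leakyReLU β}

/-- The class of all exponential linear units with positive parameter. -/
def ELU : Set (ℝ → ℝ) := {s | ∃ β : ℝ, 0 < β ∧ s = elu β}

/-- The class of all continuously differentiable exponential linear units with positive
parameter. -/
def CELU : Set (ℝ → ℝ) := {s | ∃ β : ℝ, 0 < β ∧ s = celu β}

/-- The class of all scaled exponential linear units with positive parameters. -/
def SELU : Set (ℝ → ℝ) := {s | ∃ lam β : ℝ, 0 < lam ∧ 0 < β ∧ s = selu lam β}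

/-- The class of all softplus functions with positive parameter. -/
def Softplus : Set (ℝ → ℝ) := {s | ∃ β : ℝ, 0 < β ∧ s = softplus β}

/-- The affine transformation `T_{W,b} x = W x + b`. -/
def affineMap {d e : ℕ} (W : Matrix (Fin e) (Fin d) ℝ) (b : Fin e → ℝ) (x : Fin d → ℝ) :
    Fin e → ℝ :=
  W.mulVec x + b

/-- A scalar activation function applied componentwise. -/
def componentwise {d : ℕ} (s : ℝ → ℝ) (x : Fin d → ℝ) : Fin d → ℝ := fun i => s (x i)

/-- `Nets σ m [d₁, …, d_L] n` is the set `N(σ; m, d₁, …, d_L, n)` of all functions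
`T_L ∘ s_L ∘ T_{L-1} ∘ ⋯ ∘ s₁ ∘ T₀`, where the `T_i` are affine transformations between spaces of
the prescribed dimensions and each `s_i ∈ σ` is applied componentwise. -/
def Nets (σ : Set (ℝ → ℝ)) : (m : ℕ) → List ℕ → (n : ℕ) → Set ((Fin m → ℝ) → (Fin n → ℝ))
  | m, [], n => {Φ | ∃ (W : Matrix (Fin n) (Fin m) ℝ) (b : Fin n → ℝ), Φ = affineMap W b}
  | m, d :: ds, n =>
      {Φ | ∃ (W : Matrix (Fin d) (Fin m) ℝ) (b : Fin d → ℝ), ∃ s ∈ σ, ∃ Ψ ∈ Nets σ d ds n,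
        Φ = Ψ ∘ componentwise s ∘ affineMap W b}

/-- `NetsOfWidth σ m n k`: the networks with input dimension `m`, output dimension `n`, at least
one hidden layer, and all hidden layers of dimension between `1` and `k`. -/
def NetsOfWidth (σ : Set (ℝ → ℝ)) (m n k : ℕ) : Set ((Fin m → ℝ) → (Fin n → ℝ)) :=
  {Φ | ∃ ds : List ℕ, ds ≠ [] ∧ (∀ d ∈ ds, 1 ≤ d ∧ d ≤ k) ∧ Φ ∈ Nets σ m ds n}

/-- `𝓐` compactly approximates `𝓑`: every member of `𝓑` is approximated by members of `𝓐`,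
uniformly on every compact set. The norm of `Fin n → ℝ` is the maximum norm. -/
def CompactlyApproximates {m n : ℕ} (𝓐 𝓑 : Set ((Fin m → ℝ) → (Fin n → ℝ))) : Prop :=
  ∀ f ∈ 𝓑, ∀ K : Set (Fin m → ℝ), IsCompact K → ∀ ε : ℝ, 0 < ε →
    ∃ g ∈ 𝓐, ∀ x ∈ K, ‖f x - g x‖ < ε

/-- The widths `l` for which the networks of width at most `l` compactly approximate all
continuous functions from `ℝᵐ` to `ℝⁿ`. -/
def sufficientWidths (m n : ℕ) (σ : Set (ℝ → ℝ)) : Set ℕ :=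
  {l | CompactlyApproximates (NetsOfWidth σ m n l) {f | Continuous f}}

/-- The minimum width `w_min(m, n, σ)`; it is the minimum of `sufficientWidths m n σ` when that set
is nonempty. -/
noncomputable def minWidth (m n : ℕ) (σ : Set (ℝ → ℝ)) : ℕ := sInf (sufficientWidths m n σ)

end MinWidth

/-!
For the lower bound, a layer of a network of width at most `m` with injective continuous activations
either is an open map or is constant along a line. Hence each coordinate of the network satisfies a
minimum principle on bounded open sets, and such a function cannot be close to `‖x‖` on the unit
ball.

For the upper bound, `m` neurons carry the input `x` along and the other `n` store a function `g x`,
which further layers can replace by `g ⊔ V` or `g ⊓ V` for any affine `V`. Write `M` for a constant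
with `‖f x - f a‖ ≤ τ + M ‖x - a‖²`. On the ball `‖x‖ ≤ ‖a‖` the affine function
`τ + 2 M ⟪a, a - x⟫` dominates `τ + M ‖x - a‖²`, so that clamping `g` between two affine maps forces
it to be close to `f` near `a` without increasing its distance to `f` elsewhere in this ball.
Clamping in order of increasing `‖a‖` therefore never spoils what has been achieved before.
-/

namespace MinWidth

open Filter Topology

/-! ### Activation functions -/

section OpenMap

variable {α β : Type*} [ConditionallyCompleteLinearOrder α] [TopologicalSpace α] [OrderTopology α]
  [DenselyOrdered α] [NoMinOrder α] [NoMaxOrder α] [LinearOrder β] [TopologicalSpace β]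
  [OrderTopology β] {s : α → β}

theorem isOpenMap_of_strictMono_of_continuous (hs : StrictMono s) (hc : Continuous s) :
    IsOpenMap s := by
  refine isOpenMap_iff_nhds_le.2 fun x t ht => ?_
  obtain ⟨a, b, -, hab, hsub⟩ := exists_Icc_mem_subset_of_mem_nhds (mem_map.1 ht)
  obtain ⟨hax, hxb⟩ := Icc_mem_nhds_iff.1 hab
  exact mem_of_superset (Icc_mem_nhds (hs hax) (hs hxb))
    ((intermediate_value_Icc (hax.trans hxb).le hc.continuousOn).trans
      (Set.image_subset_iff.2 hsub))

theorem isOpenMap_of_injective_of_continuous (hs : Function.Injective s) (hc : Continuous s) :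
    IsOpenMap s :=
  (hc.strictMono_of_inj hs).elim (isOpenMap_of_strictMono_of_continuous · hc) fun h =>
    isOpenMap_of_strictMono_of_continuous (β := βᵒᵈ) h hc

end OpenMap

section Activations

variable {g : ℝ → ℝ}

theorem continuous_ite_nonneg (hg : Continuous g) (h0 : g 0 = 0) :
    Continuous fun x : ℝ => if 0 ≤ x then x else g x :=
  continuous_id.if_le hg continuous_const continuous_id fun x hx => by rw [← hx, h0, id]

theorem strictMono_ite_nonneg (hg : StrictMono g) (h0 : g 0 = 0) :
    StrictMono fun x : ℝ => if 0 ≤ x then x else g x := by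
  intro x y hxy
  dsimp only
  split_ifs with hx hy hy
  · exact hxy
  · exact absurd (hx.trans hxy.le) hy
  · exact ((hg (not_le.1 hx)).trans_eq h0).trans_le hy
  · exact hg hxy

theorem strictMono_mul_exp_div_sub_one {a b : ℝ} (ha : 0 < a) (hb : 0 < b) :
    StrictMono fun x : ℝ => a * (Real.exp (x / b) - 1) := fun x y hxy => by
  dsimp only
  gcongr

theorem abs_ite_nonneg_sub_posPart_lt {x ε : ℝ} (hε : 0 < ε) (h : x < 0 → |g x| < ε) :
    |(if 0 ≤ x then x else g x) - x⁺| < ε := by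
  split_ifs with hx
  · simpa [posPart_eq_self.2 hx] using hε
  · simpa [posPart_eq_zero.2 (not_le.1 hx).le] using h (not_le.1 hx)

theorem abs_mul_exp_sub_one_lt {β x : ℝ} (hβ : 0 < β) (hx : x < 0) :
    |β * (Real.exp x - 1)| < β := by
  rw [abs_mul, abs_of_pos hβ, mul_lt_iff_lt_one_right hβ, abs_sub_comm,
    abs_of_pos (sub_pos.2 (Real.exp_lt_one_iff.2 hx))]
  linarith [Real.exp_pos x]

theorem abs_softplus_sub_posPart_le {β : ℝ} (hβ : 0 < β) (x : ℝ) :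
    |softplus β x - x⁺| ≤ Real.log 2 / β := by
  have hlower : Real.exp (β * x⁺) ≤ 1 + Real.exp (β * x) := by
    rcases le_total 0 x with h | h
    · simp [posPart_eq_self.2 h]
    · simpa [posPart_eq_zero.2 h] using (Real.exp_pos (β * x)).le
  have hupper : 1 + Real.exp (β * x) ≤ 2 * Real.exp (β * x⁺) := by
    have h1 : Real.exp (β * x) ≤ Real.exp (β * x⁺) := by gcongr; exact le_posPart x
    have h2 : 1 ≤ Real.exp (β * x⁺) := Real.one_le_exp (by positivity)
    linarith
  have hlog_lower := Real.log_le_log (Real.exp_pos _) hlower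
  have hlog_upper := Real.log_le_log (by positivity) hupper
  rw [Real.log_mul two_ne_zero (Real.exp_ne_zero _), Real.log_exp] at hlog_upper
  rw [Real.log_exp] at hlog_lower
  have hsub : softplus β x - x⁺ = (Real.log (1 + Real.exp (β * x)) - β * x⁺) / β := by
    rw [softplus]; field_simp
  rw [hsub, abs_of_nonneg (div_nonneg (sub_nonneg.2 hlog_lower) hβ.le)]
  gcongr
  linarith

end Activations

/-- `σ` approximates ReLU uniformly on bounded intervals: the condition behind the upper bound on
the minimum width. -/
def ApproximatesReLU (σ : Set (ℝ → ℝ)) : Prop :=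
  ∀ R ε : ℝ, 0 < ε → ∃ s ∈ σ, ∀ x : ℝ, |x| ≤ R → |s x - x⁺| < ε

/-- Classes of continuous injective activation functions with ReLU in their closure, for the
topology of uniform convergence on compact sets. -/
structure IsReLUVariant (σ : Set (ℝ → ℝ)) : Prop where
  continuous : ∀ s ∈ σ, Continuous s
  injective : ∀ s ∈ σ, Function.Injective s
  approximatesReLU : ApproximatesReLU σ

theorem isReLUVariant_LeakyReLU : IsReLUVariant LeakyReLU where
  continuous := by
    rintro _ ⟨β, -, rfl⟩
    exact continuous_ite_nonneg (by fun_prop) (mul_zero β)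
  injective := by
    rintro _ ⟨β, hβ, rfl⟩
    exact (strictMono_ite_nonneg (strictMono_mul_left_of_pos hβ) (mul_zero β)).injective
  approximatesReLU R ε hε := by
    refine ⟨_, ⟨ε / (|R| + 1), by positivity, rfl⟩, fun x hx =>
      abs_ite_nonneg_sub_posPart_lt hε fun _ => ?_⟩
    calc |ε / (|R| + 1) * x| = ε * (|x| / (|R| + 1)) := by
          rw [abs_mul, abs_of_pos (by positivity)]; ring
      _ < ε := mul_lt_of_lt_one_right hε
          ((div_lt_one (by positivity)).2 (by linarith [le_abs_self R]))

theorem continuous_elu (β : ℝ) : Continuous (elu β) :=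
  continuous_ite_nonneg (by fun_prop) (by simp)

theorem strictMono_elu {β : ℝ} (hβ : 0 < β) : StrictMono (elu β) :=
  strictMono_ite_nonneg (by simpa using strictMono_mul_exp_div_sub_one hβ one_pos) (by simp)

theorem abs_elu_sub_posPart_lt {β : ℝ} (hβ : 0 < β) (x : ℝ) : |elu β x - x⁺| < β :=
  abs_ite_nonneg_sub_posPart_lt (g := fun x => β * (Real.exp x - 1)) hβ (abs_mul_exp_sub_one_lt hβ)

theorem isReLUVariant_ELU : IsReLUVariant ELU where
  continuous := by
    rintro _ ⟨β, -, rfl⟩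
    exact continuous_elu β
  injective := by
    rintro _ ⟨β, hβ, rfl⟩
    exact (strictMono_elu hβ).injective
  approximatesReLU _ ε hε := ⟨_, ⟨ε, hε, rfl⟩, fun x _ => abs_elu_sub_posPart_lt hε x⟩

theorem isReLUVariant_SELU : IsReLUVariant SELU where
  continuous := by
    rintro _ ⟨lam, β, -, -, rfl⟩
    exact (continuous_elu β).const_mul lam
  injective := by
    rintro _ ⟨lam, β, hlam, hβ, rfl⟩
    exact ((strictMono_elu hβ).const_mul hlam).injective
  approximatesReLU _ ε hε := ⟨_, ⟨1, ε, one_pos, hε, rfl⟩, fun x _ => by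
    rw [show selu 1 ε x = elu ε x from one_mul _]
    exact abs_elu_sub_posPart_lt hε x⟩

theorem isReLUVariant_CELU : IsReLUVariant CELU where
  continuous := by
    rintro _ ⟨β, -, rfl⟩
    exact continuous_ite_nonneg (by fun_prop) (by simp)
  injective := by
    rintro _ ⟨β, hβ, rfl⟩
    exact (strictMono_ite_nonneg (strictMono_mul_exp_div_sub_one hβ hβ) (by simp)).injective
  approximatesReLU _ ε hε := ⟨_, ⟨ε, hε, rfl⟩, fun x _ =>
    abs_ite_nonneg_sub_posPart_lt (g := fun x => ε * (Real.exp (x / ε) - 1)) hε fun hx =>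
      abs_mul_exp_sub_one_lt hε (div_neg_of_neg_of_pos hx hε)⟩

theorem isReLUVariant_Softplus : IsReLUVariant Softplus where
  continuous := by
    rintro _ ⟨β, -, rfl⟩
    have : ∀ x : ℝ, 1 + Real.exp (β * x) ≠ 0 := fun x => by positivity
    unfold softplus
    fun_prop (disch := assumption)
  injective := by
    rintro _ ⟨β, hβ, rfl⟩
    refine StrictMono.injective fun x y hxy => ?_
    unfold softplus
    gcongr
  approximatesReLU _ ε hε := by
    refine ⟨_, ⟨1 / ε, by positivity, rfl⟩, fun x _ =>
      (abs_softplus_sub_posPart_le (by positivity) x).trans_lt ?_⟩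
    rw [div_div_eq_mul_div, div_one]
    exact mul_lt_of_lt_one_left hε (Real.log_two_lt_d9.trans (by norm_num))


/-! ### The lower bound -/

section MinimumPrinciple

variable {E F : Type*}

/-- The values of `φ` on a bounded open set are bounded below by those on its boundary. Every
coordinate of a network whose layers are no wider than its input space satisfies this principle,
but the norm does not. -/
def MinimumPrinciple [TopologicalSpace E] [Bornology E] (φ : E → ℝ) : Prop :=
  ∀ U : Set E, IsOpen U → Bornology.IsBounded U → ∀ x ∈ U, ∃ z ∈ frontier U, φ z ≤ φ x

theorem exists_add_smul_mem_frontier [NormedAddCommGroup E] [NormedSpace ℝ E] {U : Set E}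
    (hU : Bornology.IsBounded U) {x v : E} (hx : x ∈ U) (hv : v ≠ 0) :
    ∃ t : ℝ, 0 ≤ t ∧ x + t • v ∈ frontier U := by
  set ray : ℝ → E := fun t => x + |t| • v with hray
  have hcont : Continuous ray := by fun_prop
  have hne : ray ⁻¹' U ≠ Set.univ := fun h => by
    obtain ⟨C, hC⟩ := hU.exists_norm_le
    obtain ⟨t, ht⟩ : ∃ t : ℝ, C + ‖x‖ < |t| * ‖v‖ := ⟨(C + ‖x‖ + 1) / ‖v‖, by
      rw [abs_div, abs_norm, div_mul_cancel₀ _ (norm_ne_zero_iff.2 hv)]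
      exact (lt_add_one _).trans_le (le_abs_self _)⟩
    refine ht.not_ge ?_
    calc |t| * ‖v‖ = ‖ray t - x‖ := by
          rw [hray, add_sub_cancel_left, norm_smul, Real.norm_eq_abs, abs_abs]
      _ ≤ ‖ray t‖ + ‖x‖ := norm_sub_le _ _
      _ ≤ C + ‖x‖ := by gcongr; exact hC _ (h ▸ Set.mem_univ t : t ∈ ray ⁻¹' U)
  obtain ⟨t, ht⟩ := nonempty_frontier_iff.2 ⟨⟨0, by simpa [hray] using hx⟩, hne⟩
  exact ⟨|t|, abs_nonneg t, hcont.frontier_preimage_subset U ht⟩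

theorem MinimumPrinciple.of_ray [NormedAddCommGroup E] [NormedSpace ℝ E] {φ : E → ℝ} {v : E}
    (hv : v ≠ 0) (h : ∀ x, ∀ t : ℝ, 0 ≤ t → φ (x + t • v) ≤ φ x) : MinimumPrinciple φ := by
  intro U _ hU x hx
  obtain ⟨t, ht, htU⟩ := exists_add_smul_mem_frontier hU hx hv
  exact ⟨_, htU, h x t ht⟩

theorem MinimumPrinciple.comp_isOpenMap [PseudoMetricSpace E] [ProperSpace E] [MetricSpace F]
    {φ : F → ℝ} {h : E → F} (hφ : MinimumPrinciple φ) (hc : Continuous h) (ho : IsOpenMap h) :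
    MinimumPrinciple (φ ∘ h) := by
  intro U hU hUb x hx
  have hK : IsCompact (h '' closure U) := hUb.isCompact_closure.image hc
  have hsub : h '' U ⊆ h '' closure U := Set.image_mono subset_closure
  obtain ⟨_, hy, hle⟩ :=
    hφ (h '' U) (ho U hU) (hK.isBounded.subset hsub) (h x) (Set.mem_image_of_mem h hx)
  rw [(ho U hU).frontier_eq] at hy
  obtain ⟨⟨z, hz, rfl⟩, hzU⟩ := And.intro (closure_minimal hsub hK.isClosed hy.1) hy.2
  exact ⟨z, hU.frontier_eq ▸ ⟨hz, fun h' => hzU (Set.mem_image_of_mem h h')⟩, hle⟩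

end MinimumPrinciple

theorem continuous_affineMap {d e : ℕ} (W : Matrix (Fin e) (Fin d) ℝ) (b : Fin e → ℝ) :
    Continuous (affineMap W b) := by
  unfold affineMap
  fun_prop

theorem continuous_componentwise {d : ℕ} {s : ℝ → ℝ} (hs : Continuous s) :
    Continuous (componentwise s : (Fin d → ℝ) → Fin d → ℝ) := by
  unfold componentwise
  fun_prop

theorem affineMap_add_smul {d e : ℕ} (W : Matrix (Fin e) (Fin d) ℝ) (b : Fin e → ℝ)
    (x v : Fin d → ℝ) (t : ℝ) : affineMap W b (x + t • v) = affineMap W b x + t • W.mulVec v := by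
  rw [affineMap, affineMap, Matrix.mulVec_add, Matrix.mulVec_smul, add_right_comm]

theorem minimumPrinciple_affineMap_apply {m n : ℕ} (hm : 0 < m) (W : Matrix (Fin n) (Fin m) ℝ)
    (b : Fin n → ℝ) (j : Fin n) : MinimumPrinciple fun x => affineMap W b x j := by
  have : NeZero m := ⟨hm.ne'⟩
  obtain ⟨v, hv, hvj⟩ : ∃ v : Fin m → ℝ, v ≠ 0 ∧ W.mulVec v j ≤ 0 := by
    rcases le_total (W.mulVec 1 j) 0 with hle | hle
    · exact ⟨1, one_ne_zero, hle⟩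
    · exact ⟨-1, neg_ne_zero.2 one_ne_zero, by simpa [Matrix.mulVec_neg] using hle⟩
  refine .of_ray hv fun x t ht => ?_
  rw [affineMap_add_smul, Pi.add_apply]
  exact add_le_of_nonpos_right (mul_nonpos_of_nonneg_of_nonpos ht hvj)

theorem isOpenMap_affineMap {d : ℕ} {W : Matrix (Fin d) (Fin d) ℝ}
    (hW : Function.Injective W.mulVecLin) (b : Fin d → ℝ) : IsOpenMap (affineMap W b) :=
  (isOpenMap_add_right b).comp
    (W.mulVecLin.isOpenMap_of_finiteDimensional (LinearMap.injective_iff_surjective.1 hW))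

theorem minimumPrinciple_nets_apply {σ : Set (ℝ → ℝ)} (hc : ∀ s ∈ σ, Continuous s)
    (hi : ∀ s ∈ σ, Function.Injective s) {m n : ℕ} (hm : 0 < m) {ds : List ℕ}
    (hds : ∀ d ∈ ds, d ≤ m) {Φ : (Fin m → ℝ) → Fin n → ℝ} (hΦ : Φ ∈ Nets σ m ds n) (j : Fin n) :
    MinimumPrinciple fun x => Φ x j := by
  induction ds generalizing Φ with
  | nil =>
    obtain ⟨W, b, rfl⟩ := hΦ
    exact minimumPrinciple_affineMap_apply hm W b j
  | cons d ds ih =>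
    obtain ⟨W, b, s, hs, Ψ, hΨ, rfl⟩ := hΦ
    rw [List.forall_mem_cons] at hds
    by_cases hW : Function.Injective W.mulVecLin
    · obtain rfl : m = d :=
        (by simpa using LinearMap.finrank_le_finrank_of_injective hW : m ≤ d).antisymm hds.1
      exact (ih hds.2 hΨ).comp_isOpenMap ((continuous_componentwise (hc s hs)).comp
          (continuous_affineMap W b))
        ((IsOpenMap.piMap (fun _ => isOpenMap_of_injective_of_continuous (hi s hs) (hc s hs))
          (by simp)).comp (isOpenMap_affineMap hW b))
    · obtain ⟨v, hWv, hv⟩ : ∃ v, W.mulVecLin v = 0 ∧ v ≠ 0 := by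
        rw [injective_iff_map_eq_zero] at hW
        push Not at hW
        exact hW
      refine .of_ray hv fun x t _ => le_of_eq ?_
      rw [Matrix.mulVecLin_apply] at hWv
      simp only [Function.comp_apply, affineMap_add_smul, hWv, smul_zero, add_zero]

theorem lt_of_mem_sufficientWidths {σ : Set (ℝ → ℝ)} (hc : ∀ s ∈ σ, Continuous s)
    (hi : ∀ s ∈ σ, Function.Injective s) {m n l : ℕ} (hm : 0 < m) (hn : 0 < n)
    (hl : l ∈ sufficientWidths m n σ) : m < l := by
  by_contra! hlm
  set f : (Fin m → ℝ) → Fin n → ℝ := fun x _ => ‖x‖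
  obtain ⟨g, ⟨ds, -, hds, hg⟩, hfg⟩ := hl f (by fun_prop : Continuous f)
    (Metric.closedBall 0 1) (isCompact_closedBall 0 1) (1 / 3) (by norm_num)
  set j : Fin n := ⟨0, hn⟩
  have hclose : ∀ x, ‖x‖ ≤ 1 → |‖x‖ - g x j| < 1 / 3 := fun x hx =>
    (norm_le_pi_norm (f x - g x) j).trans_lt (hfg x (by simpa using hx))
  obtain ⟨z, hz, hle⟩ := minimumPrinciple_nets_apply hc hi hm (fun d hd => (hds d hd).2.trans hlm)
    hg j (Metric.ball 0 1) Metric.isOpen_ball Metric.isBounded_ball 0 (by simp)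
  have hz1 : ‖z‖ = 1 := by simpa [frontier_ball] using hz
  have h0 := abs_lt.1 (hclose 0 (by simp))
  have h1 := abs_lt.1 (hclose z hz1.le)
  rw [norm_zero] at h0
  linarith [h0.1, h1.2]

/-! ### Closure properties of networks -/

section Networks

variable {σ : Set (ℝ → ℝ)} {a b d e k m n : ℕ}

theorem exists_eq_affineMap (T : (Fin d → ℝ) →ᵃ[ℝ] (Fin e → ℝ)) :
    ∃ (W : Matrix (Fin e) (Fin d) ℝ) (c : Fin e → ℝ), ⇑T = affineMap W c :=
  ⟨LinearMap.toMatrix' T.linear, T 0, by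
    funext x
    rw [affineMap, LinearMap.toMatrix'_mulVec]
    exact congrFun T.decomp x⟩

theorem affineMap_comp_affineMap (V : Matrix (Fin e) (Fin b) ℝ) (v : Fin e → ℝ)
    (W : Matrix (Fin b) (Fin a) ℝ) (c : Fin b → ℝ) :
    affineMap V v ∘ affineMap W c = affineMap (V * W) (V.mulVec c + v) := by
  funext x
  simp only [Function.comp_apply, affineMap, Matrix.mulVec_add, Matrix.mulVec_mulVec, add_assoc]

theorem nets_comp_affineMap {ds : List ℕ} {Ψ : (Fin b → ℝ) → Fin n → ℝ} (hΨ : Ψ ∈ Nets σ b ds n)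
    (W : Matrix (Fin b) (Fin a) ℝ) (c : Fin b → ℝ) : Ψ ∘ affineMap W c ∈ Nets σ a ds n := by
  cases ds with
  | nil =>
    obtain ⟨V, v, rfl⟩ := hΨ
    exact ⟨_, _, affineMap_comp_affineMap V v W c⟩
  | cons d ds =>
    obtain ⟨V, v, s, hs, Θ, hΘ, rfl⟩ := hΨ
    exact ⟨_, _, s, hs, Θ, hΘ, by rw [← affineMap_comp_affineMap V v W c]; rfl⟩

theorem nets_comp {ds es : List ℕ} {Φ : (Fin a → ℝ) → Fin b → ℝ} {Ψ : (Fin b → ℝ) → Fin n → ℝ}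
    (hΨ : Ψ ∈ Nets σ b es n) (hΦ : Φ ∈ Nets σ a ds b) : Ψ ∘ Φ ∈ Nets σ a (ds ++ es) n := by
  induction ds generalizing a with
  | nil =>
    obtain ⟨W, c, rfl⟩ := hΦ
    exact nets_comp_affineMap hΨ W c
  | cons d ds ih =>
    obtain ⟨W, c, s, hs, Θ, hΘ, rfl⟩ := hΦ
    exact ⟨W, c, s, hs, Ψ ∘ Θ, ih hΘ, rfl⟩

theorem netsOfWidth_comp {Φ : (Fin a → ℝ) → Fin b → ℝ} {Ψ : (Fin b → ℝ) → Fin n → ℝ}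
    (hΨ : Ψ ∈ NetsOfWidth σ b n k) (hΦ : Φ ∈ NetsOfWidth σ a b k) :
    Ψ ∘ Φ ∈ NetsOfWidth σ a n k := by
  obtain ⟨ds, hds, hds_width, hΦ⟩ := hΦ
  obtain ⟨es, -, hes_width, hΨ⟩ := hΨ
  exact ⟨ds ++ es, by simp [hds], List.forall_mem_append.2 ⟨hds_width, hes_width⟩, nets_comp hΨ hΦ⟩

theorem affine_comp_netsOfWidth {Φ : (Fin a → ℝ) → Fin b → ℝ} (hΦ : Φ ∈ NetsOfWidth σ a b k)
    (T : (Fin b → ℝ) →ᵃ[ℝ] (Fin n → ℝ)) : T ∘ Φ ∈ NetsOfWidth σ a n k := by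
  obtain ⟨ds, hds, hds_width, hΦ⟩ := hΦ
  exact ⟨ds, hds, hds_width, by simpa using nets_comp (es := []) (exists_eq_affineMap T) hΦ⟩

theorem componentwise_comp_affine_mem_netsOfWidth {s : ℝ → ℝ} (hs : s ∈ σ) (hd : 1 ≤ d)
    (T : (Fin a → ℝ) →ᵃ[ℝ] (Fin d → ℝ)) : componentwise s ∘ T ∈ NetsOfWidth σ a d d := by
  obtain ⟨W, c, hT⟩ := exists_eq_affineMap T
  exact ⟨[d], by simp, by simpa using hd, W, c, s, hs, id, exists_eq_affineMap (.id ℝ _),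
    by rw [hT]; rfl⟩

theorem compactlyApproximates_refl (𝓐 : Set ((Fin a → ℝ) → Fin b → ℝ)) :
    CompactlyApproximates 𝓐 𝓐 :=
  fun f hf _ _ _ hε => ⟨f, hf, fun x _ => by simpa using hε⟩

theorem CompactlyApproximates.trans {𝓐 𝓑 𝓒 : Set ((Fin a → ℝ) → Fin b → ℝ)}
    (h₁ : CompactlyApproximates 𝓐 𝓑) (h₂ : CompactlyApproximates 𝓑 𝓒) :
    CompactlyApproximates 𝓐 𝓒 := by
  intro f hf K hK ε hε
  obtain ⟨g, hg, hfg⟩ := h₂ f hf K hK (ε / 2) (half_pos hε)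
  obtain ⟨h, hh, hgh⟩ := h₁ g hg K hK (ε / 2) (half_pos hε)
  refine ⟨h, hh, fun x hx => ?_⟩
  linarith [hfg x hx, hgh x hx, norm_sub_le_norm_sub_add_norm_sub (f x) (g x) (h x)]

theorem CompactlyApproximates.comp {𝓐 : Set ((Fin a → ℝ) → Fin b → ℝ)}
    {𝓑 : Set ((Fin b → ℝ) → Fin n → ℝ)} {𝓒 : Set ((Fin a → ℝ) → Fin n → ℝ)}
    {F : (Fin a → ℝ) → Fin b → ℝ} {G : (Fin b → ℝ) → Fin n → ℝ}
    (hG : CompactlyApproximates 𝓑 {G}) (hF : CompactlyApproximates 𝓐 {F}) (hGc : Continuous G)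
    (hFc : Continuous F) (h : ∀ ψ ∈ 𝓑, ∀ φ ∈ 𝓐, ψ ∘ φ ∈ 𝓒) :
    CompactlyApproximates 𝓒 {G ∘ F} := by
  rintro _ rfl K hK ε hε
  set K' := Metric.cthickening 1 (F '' K)
  have hK' : IsCompact K' := (hK.image hFc).cthickening
  obtain ⟨δ, hδ, hGδ⟩ := Metric.uniformContinuousOn_iff.1
    (hK'.uniformContinuousOn_of_continuous hGc.continuousOn) (ε / 2) (half_pos hε)
  obtain ⟨ψ, hψ, hGψ⟩ := hG G rfl K' hK' (ε / 2) (half_pos hε)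
  obtain ⟨φ, hφ, hFφ⟩ := hF F rfl K hK (min δ 1) (lt_min hδ one_pos)
  refine ⟨ψ ∘ φ, h ψ hψ φ hφ, fun x hx => ?_⟩
  have hdist : dist (F x) (φ x) < min δ 1 := by rw [dist_eq_norm]; exact hFφ x hx
  have hFx : F x ∈ K' := Metric.self_subset_cthickening _ (Set.mem_image_of_mem F hx)
  have hφx : φ x ∈ K' := Metric.mem_cthickening_of_dist_le _ (F x) _ _ (Set.mem_image_of_mem F hx)
    (by rw [dist_comm]; exact (hdist.trans_le (min_le_right _ _)).le)
  have hGFφ := hGδ _ hFx _ hφx (hdist.trans_le (min_le_left _ _))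
  rw [dist_eq_norm] at hGFφ
  calc ‖(G ∘ F) x - (ψ ∘ φ) x‖ ≤ ‖G (F x) - G (φ x)‖ + ‖G (φ x) - ψ (φ x)‖ :=
        norm_sub_le_norm_sub_add_norm_sub _ _ _
    _ < ε := by linarith [hGψ _ hφx]

theorem CompactlyApproximates.affine_comp {F : (Fin a → ℝ) → Fin b → ℝ}
    (hF : CompactlyApproximates (NetsOfWidth σ a b k) {F}) (hFc : Continuous F)
    (T : (Fin b → ℝ) →ᵃ[ℝ] (Fin n → ℝ)) :
    CompactlyApproximates (NetsOfWidth σ a n k) {T ∘ F} :=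
  (compactlyApproximates_refl {⇑T}).comp hF T.continuous_of_finiteDimensional hFc
    fun _ hψ _ hφ => by
      rw [Set.mem_singleton_iff.1 hψ]
      exact affine_comp_netsOfWidth hφ T

theorem ApproximatesReLU.posPart_affine (hσ : ApproximatesReLU σ) (hd : 1 ≤ d)
    (T : (Fin a → ℝ) →ᵃ[ℝ] (Fin d → ℝ)) :
    CompactlyApproximates (NetsOfWidth σ a d d) {fun x => (T x)⁺} := by
  rintro _ rfl K hK ε hε
  obtain ⟨R, hR⟩ := (hK.image T.continuous_of_finiteDimensional).isBounded.exists_norm_le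
  obtain ⟨s, hs, hsR⟩ := hσ R ε hε
  refine ⟨_, componentwise_comp_affine_mem_netsOfWidth hs hd T, fun x hx =>
    (pi_norm_lt_iff hε).2 fun i => ?_⟩
  rw [Pi.sub_apply, norm_sub_rev]
  exact hsR _ ((norm_le_pi_norm (T x) i).trans (hR _ (Set.mem_image_of_mem _ hx)))

/-- The affine map `x ↦ (S x, T x)`, in the coordinates of `Fin (m + n)`. -/
def appendAffine (S : (Fin a → ℝ) →ᵃ[ℝ] (Fin m → ℝ)) (T : (Fin a → ℝ) →ᵃ[ℝ] (Fin n → ℝ)) :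
    (Fin a → ℝ) →ᵃ[ℝ] (Fin (m + n) → ℝ) :=
  AffineMap.pi (Fin.append (fun i => (AffineMap.proj i).comp S) fun j => (AffineMap.proj j).comp T)

theorem appendAffine_apply (S : (Fin a → ℝ) →ᵃ[ℝ] (Fin m → ℝ))
    (T : (Fin a → ℝ) →ᵃ[ℝ] (Fin n → ℝ)) (x : Fin a → ℝ) :
    appendAffine S T x = Fin.append (S x) (T x) := by
  funext i
  refine Fin.addCases (fun i => ?_) (fun i => ?_) i <;> simp [appendAffine]

end Networks

instance hasSolidNorm_pi {ι : Type*} {E : ι → Type*} [Fintype ι] [∀ i, NormedAddCommGroup (E i)]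
    [∀ i, Lattice (E i)] [∀ i, HasSolidNorm (E i)] : HasSolidNorm (∀ i, E i) where
  solid _ y h := (pi_norm_le_iff_of_nonneg (norm_nonneg y)).2 fun i =>
    (norm_le_norm_of_abs_le_abs (h i)).trans (norm_le_pi_norm y i)

/-! ### Registers -/

section Registers

variable {σ : Set (ℝ → ℝ)} {a m n : ℕ} {g : (Fin m → ℝ) → Fin n → ℝ}

@[fun_prop]
theorem continuous_append {X : Type*} [TopologicalSpace X] {f : X → Fin m → ℝ}
    {g : X → Fin n → ℝ} (hf : Continuous f) (hg : Continuous g) :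
    Continuous fun x => Fin.append (f x) (g x) :=
  (Fin.continuous_append m n).comp (hf.prodMk hg)

/-- On a compact set, ReLU acts as the identity on `S` after `S` is shifted to be positive. -/
theorem ApproximatesReLU.append_posPart (hσ : ApproximatesReLU σ) (hmn : 1 ≤ m + n)
    (S : (Fin a → ℝ) →ᵃ[ℝ] (Fin m → ℝ)) (T : (Fin a → ℝ) →ᵃ[ℝ] (Fin n → ℝ)) :
    CompactlyApproximates (NetsOfWidth σ a (m + n) (m + n))
      {fun z => Fin.append (S z) (T z)⁺} := by
  rintro _ rfl K hK ε hε
  obtain ⟨B, hB⟩ := (hK.image S.continuous_of_finiteDimensional).isBounded.bddBelow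
  set A := appendAffine (S - .const ℝ _ B) T
  set shift : (Fin (m + n) → ℝ) →ᵃ[ℝ] (Fin (m + n) → ℝ) :=
    .id ℝ _ + .const ℝ _ (Fin.append B 0)
  have hshift : ∀ z ∈ K, Fin.append (S z) (T z)⁺ = shift (A z)⁺ := fun z hz => by
    have hSz : B ≤ S z := hB (Set.mem_image_of_mem S hz)
    funext i
    refine Fin.addCases (fun i => ?_) (fun j => ?_) i
    · simp [A, shift, appendAffine_apply, hSz i, Pi.posPart_apply]
    · simp [A, shift, appendAffine_apply, Pi.posPart_apply]
  obtain ⟨g, hg, hgK⟩ := (hσ.posPart_affine hmn A).affine_comp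
    (continuous_posPart.comp A.continuous_of_finiteDimensional) shift _ rfl K hK ε hε
  refine ⟨g, hg, fun z hz => ?_⟩
  simpa only [Function.comp_apply, ← hshift z hz] using hgK z hz

/-- A continuous map `g` such that `x ↦ (x, g x)` is approximated by networks of width `m + n`.
Such a network keeps its input in `m` neurons and stores a function of the input, which later
layers may modify, in the remaining `n` neurons. -/
def IsRegister (σ : Set (ℝ → ℝ)) (g : (Fin m → ℝ) → Fin n → ℝ) : Prop :=
  Continuous g ∧
    CompactlyApproximates (NetsOfWidth σ m (m + n) (m + n)) {fun x => Fin.append x (g x)}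

theorem isRegister_zero (hσ : ApproximatesReLU σ) (hmn : 1 ≤ m + n) :
    IsRegister σ (0 : (Fin m → ℝ) → Fin n → ℝ) :=
  ⟨continuous_zero, by simpa using hσ.append_posPart hmn (.id ℝ (Fin m → ℝ)) 0⟩

theorem IsRegister.update (hσ : ApproximatesReLU σ) (hmn : 1 ≤ m + n) (hg : IsRegister σ g)
    (V : (Fin m → ℝ) →ᵃ[ℝ] (Fin n → ℝ)) (κ : ℝ) :
    IsRegister σ fun x => V x + κ • (κ • (g x - V x))⁺ := by
  obtain ⟨hgc, hg⟩ := hg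
  have hVc := V.continuous_of_finiteDimensional
  set left : (Fin (m + n) → ℝ) →ᵃ[ℝ] (Fin m → ℝ) :=
    (LinearMap.funLeft ℝ ℝ (Fin.castAdd n)).toAffineMap with hleft
  set right : (Fin (m + n) → ℝ) →ᵃ[ℝ] (Fin n → ℝ) :=
    (LinearMap.funLeft ℝ ℝ (Fin.natAdd m)).toAffineMap with hright
  have left_append : ∀ x y, left (Fin.append x y) = x := fun x y => by
    funext i; simp [hleft, LinearMap.funLeft_apply]
  have right_append : ∀ x y, right (Fin.append x y) = y := fun x y => by
    funext i; simp [hright, LinearMap.funLeft_apply]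
  have hpos : Continuous fun x => (κ • (g x - V x))⁺ := continuous_posPart.comp (by fun_prop)
  have hlayer : CompactlyApproximates (NetsOfWidth σ m (m + n) (m + n))
      {fun x => Fin.append x (κ • (g x - V x))⁺} := by
    have hpos' : Continuous fun z => ((κ • (right - V.comp left)) z)⁺ :=
      continuous_posPart.comp (AffineMap.continuous_of_finiteDimensional _)
    simpa [Function.comp_def, left_append, right_append] using
      (hσ.append_posPart hmn left (κ • (right - V.comp left))).comp hg
        (continuous_append left.continuous_of_finiteDimensional hpos') (by fun_prop)
        fun _ hψ _ hφ => netsOfWidth_comp hψ hφ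
  refine ⟨hVc.add (hpos.const_smul κ), ?_⟩
  simpa [Function.comp_def, appendAffine_apply, left_append, right_append] using
    hlayer.affine_comp (by fun_prop) (appendAffine left (V.comp left + κ • right))

theorem IsRegister.sup (hσ : ApproximatesReLU σ) (hmn : 1 ≤ m + n) (hg : IsRegister σ g)
    (V : (Fin m → ℝ) →ᵃ[ℝ] (Fin n → ℝ)) : IsRegister σ (g ⊔ ⇑V) := by
  convert hg.update hσ hmn V 1 using 2 with x
  rw [one_smul, one_smul, Pi.sup_apply, sup_eq_add_posPart_sub]

theorem IsRegister.inf (hσ : ApproximatesReLU σ) (hmn : 1 ≤ m + n) (hg : IsRegister σ g)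
    (V : (Fin m → ℝ) →ᵃ[ℝ] (Fin n → ℝ)) : IsRegister σ (g ⊓ ⇑V) := by
  convert hg.update hσ hmn V (-1) using 2 with x
  rw [neg_one_smul, neg_one_smul, neg_sub, ← sub_eq_add_neg, Pi.inf_apply, inf_comm,
    inf_eq_sub_posPart_sub]

theorem compactlyApproximates_isRegister :
    CompactlyApproximates (NetsOfWidth σ m n (m + n)) {g | IsRegister σ g} := by
  intro g hg
  obtain ⟨hgc, happrox⟩ := hg
  refine happrox.affine_comp (by fun_prop) (LinearMap.funLeft ℝ ℝ (Fin.natAdd m)).toAffineMap g ?_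
  funext x j
  simp [LinearMap.funLeft_apply]

end Registers

/-! ### Approximation by clamping between affine maps -/

section Clamping

theorem norm_sup_inf_sub_le {α : Type*} [NormedAddCommGroup α] [Lattice α] [HasSolidNorm α]
    [IsOrderedAddMonoid α] {b u v : α} (y : α) (hv : v ≤ b) (hu : b ≤ u) :
    ‖(y ⊔ v) ⊓ u - b‖ ≤ ‖y - b‖ :=
  calc ‖(y ⊔ v) ⊓ u - b‖ = ‖(y ⊔ v) ⊓ u - (b ⊔ v) ⊓ u‖ := by
        rw [sup_eq_left.2 hv, inf_eq_left.2 hu]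
    _ ≤ ‖y ⊔ v - b ⊔ v‖ := norm_inf_sub_inf_le_norm _ _ _
    _ ≤ ‖y - b‖ := norm_sup_sub_sup_le_norm _ _ _

theorem norm_sub_le_norm_sub_of_mem_Icc {α : Type*} [NormedAddCommGroup α] [Lattice α]
    [HasSolidNorm α] [IsOrderedAddMonoid α] {b c u v : α} (hb : b ∈ Set.Icc v u)
    (hc : c ∈ Set.Icc v u) : ‖c - b‖ ≤ ‖u - v‖ := by
  refine norm_le_norm_of_abs_le_abs
    ((abs_le'.2 ⟨sub_le_sub hc.2 hb.1, ?_⟩).trans (le_abs_self _))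
  rw [neg_sub]
  exact sub_le_sub hb.2 hc.1

/-- Clamping `g` between `lo a` and `hi a` is harmless where these are barriers for `f`, hence
wherever `ρ x ≤ ρ a`. The clamps are performed in order of increasing `ρ`, so that each of them is
harmless at all points controlled by an earlier one. -/
theorem exists_mem_forall_norm_sub_le_of_barriers {X F R : Type*} [LinearOrder R]
    [NormedAddCommGroup F] [Lattice F] [HasSolidNorm F] [IsOrderedAddMonoid F] {𝓡 : Set (X → F)}
    (hne : 𝓡.Nonempty) {lo hi : X → X → F} (hclamp : ∀ g ∈ 𝓡, ∀ a, (g ⊔ lo a) ⊓ hi a ∈ 𝓡)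
    {f : X → F} {K : Set X} (ρ : X → R) (P : Finset X)
    (hf : ∀ a ∈ P, ∀ x ∈ K, ρ x ≤ ρ a → f x ∈ Set.Icc (lo a x) (hi a x)) :
    ∃ g ∈ 𝓡, ∀ x ∈ K, ∀ p ∈ P, ρ x ≤ ρ p → ‖g x - f x‖ ≤ ‖hi p x - lo p x‖ := by
  classical
  induction P using Finset.induction_on_max_value ρ with
  | empty =>
    obtain ⟨g, hg⟩ := hne
    exact ⟨g, hg, by simp⟩
  | insert a P _ hmax ih =>
    rw [Finset.forall_mem_insert] at hf
    obtain ⟨g, hg, hgf⟩ := ih hf.2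
    refine ⟨_, hclamp g hg a, fun x hx => Finset.forall_mem_insert _ _ _ |>.2
      ⟨fun hxa => ?_, fun p hp hxp => ?_⟩⟩
    · obtain ⟨hlo, hhi⟩ := hf.1 x hx hxa
      exact norm_sub_le_norm_sub_of_mem_Icc ⟨hlo, hhi⟩
        ⟨le_inf le_sup_right (hlo.trans hhi), inf_le_right⟩
    · obtain ⟨hlo, hhi⟩ := hf.1 x hx (hxp.trans (hmax p hp))
      exact (norm_sup_inf_sub_le _ hlo hhi).trans (hgf x hx p hp hxp)

theorem exists_forall_dist_le_add_mul_sq {X Y : Type*} [PseudoMetricSpace X] [PseudoMetricSpace Y]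
    {f : X → Y} (hf : Continuous f) {K : Set X} (hK : IsCompact K) {τ : ℝ} (hτ : 0 < τ) :
    ∃ δ > 0, ∃ M ≥ 0, ∀ x ∈ K, ∀ p ∈ Metric.thickening δ K,
      dist (f x) (f p) ≤ τ + M * dist x p ^ 2 := by
  obtain ⟨δ, hδ, hnear⟩ := Metric.mem_uniformity_dist.1
    (hK.uniformContinuousAt_of_continuousAt f (fun x _ => hf.continuousAt)
      (Metric.dist_mem_uniformity hτ))
  have hdiam := (hK.image hf).isBounded
  refine ⟨δ, hδ, Metric.diam (f '' K) / δ ^ 2, by positivity, fun x hx p hp => ?_⟩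
  rcases lt_or_ge (dist x p) δ with hxp | hxp
  · exact (hnear hxp hx).le.trans (le_add_of_nonneg_right (by positivity))
  · obtain ⟨y, hy, hpy⟩ := Metric.mem_thickening_iff.1 hp
    calc dist (f x) (f p) ≤ dist (f x) (f y) + dist (f y) (f p) := dist_triangle _ _ _
      _ ≤ Metric.diam (f '' K) + τ := by
        gcongr
        · exact Metric.dist_le_diam_of_mem hdiam (Set.mem_image_of_mem f hx)
            (Set.mem_image_of_mem f hy)
        · exact (hnear (dist_comm p y ▸ hpy) hy).le
      _ = τ + Metric.diam (f '' K) / δ ^ 2 * δ ^ 2 := by field_simp; ring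
      _ ≤ τ + Metric.diam (f '' K) / δ ^ 2 * dist x p ^ 2 := by gcongr

variable {E ι : Type*} [NormedAddCommGroup E] [InnerProductSpace ℝ E]

open scoped RealInnerProductSpace

theorem norm_sub_sq_le_two_mul_inner {a x : E} (h : ‖x‖ ≤ ‖a‖) :
    ‖x - a‖ ^ 2 ≤ 2 * ⟪a, a - x⟫ := by
  have := pow_le_pow_left₀ (norm_nonneg x) h 2
  rw [norm_sub_sq_real, inner_sub_right, real_inner_self_eq_norm_sq, real_inner_comm]
  linarith

theorem exists_norm_lt_of_mem_nhds [Nontrivial E] {x : E} {U : Set E} (hU : U ∈ 𝓝 x) :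
    ∃ p ∈ U, ‖x‖ < ‖p‖ := by
  have hx : x ∈ closure (Metric.closedBall 0 ‖x‖)ᶜ := by
    rw [closure_compl, interior_closedBall']
    simp
  obtain ⟨p, hpU, hp⟩ := mem_closure_iff_nhds.1 hx U hU
  exact ⟨p, hpU, by simpa using hp⟩

/-- The affine map `x ↦ c + (τ + 2 M ⟪a, a - x⟫) • 1`. On the ball `‖x‖ ≤ ‖a‖` it lies above the
paraboloid `c + (τ + M ‖x - a‖²) • 1` if `0 ≤ M`. -/
noncomputable def barrier (a : E) (M τ : ℝ) (c : ι → ℝ) : E →ᴬ[ℝ] (ι → ℝ) :=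
  .const ℝ E (c + (τ + 2 * M * ‖a‖ ^ 2) • 1) -
    ((2 * M) • (innerSL ℝ a).smulRight (1 : ι → ℝ)).toContinuousAffineMap

theorem barrier_apply (a : E) (M τ : ℝ) (c : ι → ℝ) (x : E) :
    barrier a M τ c x = c + (τ + 2 * M * ⟪a, a - x⟫) • 1 := by
  funext i
  calc barrier a M τ c x i = c i + (τ + 2 * M * ‖a‖ ^ 2) - 2 * M * ⟪a, x⟫ := by simp [barrier]
    _ = c i + (τ + 2 * M * ⟪a, a - x⟫) := by
      rw [inner_sub_right, real_inner_self_eq_norm_sq]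
      ring
    _ = (c + (τ + 2 * M * ⟪a, a - x⟫) • 1) i := by simp

theorem mem_Icc_barrier [Fintype ι] {a x : E} (hxa : ‖x‖ ≤ ‖a‖) {M τ : ℝ} (hM : 0 ≤ M)
    {y c : ι → ℝ} (h : dist y c ≤ τ + M * dist x a ^ 2) :
    y ∈ Set.Icc (barrier a (-M) (-τ) c x) (barrier a M τ c x) := by
  have hpar : dist y c ≤ τ + 2 * M * ⟪a, a - x⟫ := by
    have := mul_le_mul_of_nonneg_left (norm_sub_sq_le_two_mul_inner hxa) hM
    rw [dist_eq_norm x a] at h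
    linarith
  have hcoord : ∀ i, -(τ + 2 * M * ⟪a, a - x⟫) ≤ y i - c i ∧ y i - c i ≤ τ + 2 * M * ⟪a, a - x⟫ :=
    fun i => abs_le.1 ((dist_le_pi_dist y c i).trans hpar)
  constructor <;> intro i <;>
    simp only [barrier_apply, Pi.add_apply, Pi.smul_apply, Pi.one_apply, smul_eq_mul]
  · linarith [(hcoord i).1]
  · linarith [(hcoord i).2]

theorem norm_barrier_sub_barrier_le [Fintype ι] {a x : E} (hxa : ‖x‖ ≤ ‖a‖) {M τ : ℝ} (hM : 0 ≤ M)
    (hτ : 0 ≤ τ) (c : ι → ℝ) :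
    ‖barrier a M τ c x - barrier a (-M) (-τ) c x‖ ≤ 2 * (τ + 2 * M * ⟪a, a - x⟫) := by
  have : 0 ≤ ⟪a, a - x⟫ := by nlinarith [norm_sub_sq_le_two_mul_inner hxa, sq_nonneg ‖x - a‖]
  refine (pi_norm_le_iff_of_nonneg (by positivity)).2 fun i => le_of_eq ?_
  have hi : (barrier a M τ c x - barrier a (-M) (-τ) c x) i = 2 * (τ + 2 * M * ⟪a, a - x⟫) := by
    simp only [barrier_apply, Pi.sub_apply, Pi.add_apply, Pi.smul_apply, Pi.one_apply, smul_eq_mul]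
    ring
  rw [hi, Real.norm_of_nonneg (by positivity)]

theorem exists_mem_forall_norm_sub_lt [Nontrivial E] [Fintype ι] {𝓡 : Set (E → ι → ℝ)}
    (hne : 𝓡.Nonempty) (hsup : ∀ g ∈ 𝓡, ∀ V : E →ᴬ[ℝ] (ι → ℝ), g ⊔ ⇑V ∈ 𝓡)
    (hinf : ∀ g ∈ 𝓡, ∀ V : E →ᴬ[ℝ] (ι → ℝ), g ⊓ ⇑V ∈ 𝓡) {f : E → ι → ℝ} (hf : Continuous f)
    {K : Set E} (hK : IsCompact K) {ε : ℝ} (hε : 0 < ε) :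
    ∃ g ∈ 𝓡, ∀ x ∈ K, ‖f x - g x‖ < ε := by
  obtain ⟨τ, hτ, rfl⟩ : ∃ τ > 0, 4 * τ = ε := ⟨ε / 4, by positivity, by ring⟩
  obtain ⟨δ, hδ, M, hM, hfM⟩ := exists_forall_dist_le_add_mul_sq hf hK hτ
  set S := Metric.thickening δ K
  set N : E → Set E := fun p => {x | ‖x‖ < ‖p‖ ∧ 2 * M * ⟪p, p - x⟫ < τ}
  have hNopen : ∀ p, IsOpen (N p) := fun p => by
    have hinner : Continuous fun x : E => 2 * M * ⟪p, p - x⟫ := by fun_prop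
    exact (isOpen_lt continuous_norm continuous_const).inter (isOpen_lt hinner continuous_const)
  have hcover : K ⊆ ⋃ p ∈ S, N p := fun x hx => by
    have hS : S ∈ 𝓝 x := Metric.isOpen_thickening.mem_nhds (Metric.self_subset_thickening hδ K hx)
    have hinner : {p : E | 2 * M * ⟪p, p - x⟫ < τ} ∈ 𝓝 x :=
      (isOpen_lt (by fun_prop) continuous_const).mem_nhds (by simpa using hτ)
    obtain ⟨p, ⟨hpS, hp⟩, hxp⟩ := exists_norm_lt_of_mem_nhds (inter_mem hS hinner)
    exact Set.mem_biUnion hpS ⟨hxp, hp⟩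
  obtain ⟨P, hPS, hP, hKP⟩ := hK.elim_finite_subcover_image (fun p _ => hNopen p) hcover
  obtain ⟨g, hg, hgf⟩ := exists_mem_forall_norm_sub_le_of_barriers hne
    (lo := fun a => barrier a (-M) (-τ) (f a)) (hi := fun a => barrier a M τ (f a))
    (fun g hg a => hinf _ (hsup g hg _) _) (f := f) (K := K) norm hP.toFinset fun a ha x hx hxa =>
      mem_Icc_barrier hxa hM (hfM x hx a (hPS (hP.mem_toFinset.1 ha)))
  refine ⟨g, hg, fun x hx => ?_⟩
  obtain ⟨p, hp, hxp, hpx⟩ := Set.mem_iUnion₂.1 (hKP hx)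
  calc ‖f x - g x‖ = ‖g x - f x‖ := norm_sub_rev _ _
    _ ≤ _ := hgf x hx p (hP.mem_toFinset.2 hp) hxp.le
    _ ≤ 2 * (τ + 2 * M * ⟪p, p - x⟫) := norm_barrier_sub_barrier_le hxp.le hM hτ.le _
    _ < 4 * τ := by linarith

end Clamping


theorem compactlyApproximates_continuous_of_isRegister {σ : Set (ℝ → ℝ)} {m n : ℕ}
    (hσ : ApproximatesReLU σ) (hm : 0 < m) :
    CompactlyApproximates {g : (Fin m → ℝ) → (Fin n → ℝ) | IsRegister σ g} {f | Continuous f} := by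
  have : NeZero m := ⟨hm.ne'⟩
  intro f hf K hK ε hε
  -- The barriers need an inner product, which `Fin m → ℝ` with its sup norm does not have.
  let e := EuclideanSpace.equiv (Fin m) ℝ
  have : Nontrivial (EuclideanSpace ℝ (Fin m)) := e.toEquiv.nontrivial
  let pullback (V : EuclideanSpace ℝ (Fin m) →ᴬ[ℝ] (Fin n → ℝ)) : (Fin m → ℝ) →ᵃ[ℝ] (Fin n → ℝ) :=
    V.toAffineMap.comp e.symm.toLinearMap.toAffineMap
  obtain ⟨g, hg, hfg⟩ := exists_mem_forall_norm_sub_lt (𝓡 := {g | IsRegister σ (g ∘ e.symm)})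
    ⟨0, isRegister_zero hσ (by lia)⟩ (fun g hg V => hg.sup hσ (by lia) (pullback V))
    (fun g hg V => hg.inf hσ (by lia) (pullback V)) (hf.comp e.continuous)
    (hK.image e.symm.continuous) hε
  exact ⟨_, hg, fun x hx => by simpa using hfg _ (Set.mem_image_of_mem _ hx)⟩

theorem add_mem_sufficientWidths {σ : Set (ℝ → ℝ)} {m n : ℕ} (hσ : ApproximatesReLU σ)
    (hm : 0 < m) : m + n ∈ sufficientWidths m n σ :=
  compactlyApproximates_isRegister.trans (compactlyApproximates_continuous_of_isRegister hσ hm)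

end MinWidth

theorem mainTheorem3_general (m n : ℕ) (hm : 0 < m) (hn : 0 < n) (σ : Set (ℝ → ℝ))
    (hσ : MinWidth.IsReLUVariant σ) :
    (MinWidth.sufficientWidths m n σ).Nonempty ∧
      m + 1 ≤ MinWidth.minWidth m n σ ∧ MinWidth.minWidth m n σ ≤ m + n := by
  have hmem : m + n ∈ MinWidth.sufficientWidths m n σ :=
    MinWidth.add_mem_sufficientWidths hσ.approximatesReLU hm
  exact ⟨⟨_, hmem⟩, MinWidth.lt_of_mem_sufficientWidths hσ.continuous hσ.injective hm hn
    (Nat.sInf_mem ⟨_, hmem⟩), Nat.sInf_le hmem⟩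

theorem mainTheorem3 (m n : ℕ) (hm : 0 < m) (hn : 0 < n) (σ : Set (ℝ → ℝ))
    (hσ : σ = MinWidth.LeakyReLU ∨ σ = MinWidth.ELU ∨ σ = MinWidth.SELU ∨
      σ = MinWidth.Softplus ∨ σ = MinWidth.CELU) :
    (MinWidth.sufficientWidths m n σ).Nonempty ∧
      m + 1 ≤ MinWidth.minWidth m n σ ∧ MinWidth.minWidth m n σ ≤ m + n := by
  refine mainTheorem3_general m n hm hn σ ?_
  rcases hσ with rfl | rfl | rfl | rfl | rfl
  exacts [MinWidth.isReLUVariant_LeakyReLU, MinWidth.isReLUVariant_ELU,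
    MinWidth.isReLUVariant_SELU, MinWidth.isReLUVariant_Softplus, MinWidth.isReLUVariant_CELU]
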